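/- Let $n\ge 1$, let $\mathbb M(n)$ be the space of $n\times n$ complex matrices, and let $\|A\|=\sup\{\|Av\|_2 : v\in\mathbb C^n,\ \|v\|_2\le 1\}$ be the operator norm with respect to the Euclidean norm. Let $\operatorname{per}A=\sum_{\sigma\in S_n}\prod_{i=1}^n a_{i\sigma(i)}$ be the permanent. The map $\operatorname{per}:\mathbb M(n)\to\mathbb C$ is infinitely differentiable; let $D^m\operatorname{per}A$ denote its $m$-th (complex) derivative at $A$, an $m$-linear map $\mathbb M(n)^m\to\mathbb C$, with norm $$\|D^m\operatorname{per}A\|=\sup_{\|X^1\|=\cdots=\|X^m\|=1}|D^m\operatorname{per}(A)(X^1,\dots,X^m)|.$$ (i) For all $1\le m\le n$ and all $A\in\mathbb M(n)$, $$\|D^m\operatorname{per}A\|\le\frac{n!}{(n-m)!}\,\|A\|^{n-m}.$$ (ii) For all $A,X\in\mathbb M(n)$, $$|\operatorname{per}(A+X)-\operatorname{per}A|\le(\|A\|+\|X\|)^n-\|A\|^n.$$ (iii) The bound in (ii) is attained at $A=I$, $X=xI$ for every real $x\ge 0$: both sides are then equal to $\sum_{k=1}^n\binom nk x^k$. -/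

import Mathlib

-- `‖A‖` for a matrix `A` is the operator norm induced by the Euclidean norm on `ℂⁿ`.
open scoped Matrix.Norms.L2Operator
open scoped ContDiff

/-! The permanent is the diagonal of the `n`-linear form L(X¹,…,Xⁿ) = (1/n!) ⟨1_S, (X¹ ⊗ ⋯ ⊗ Xⁿ)
1_S⟩, where S is the set of permutations inside all maps `Fin n → Fin n`. Since ‖1_S‖² = n! and the
tensor product has norm at most ∏ ‖Xⁱ‖, Cauchy–Schwarz gives ‖L‖ ≤ 1
(`Matrix.norm_sum_perm_perm_le`). Both inequalities then hold for the diagonal of any multilinear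
map of norm at most 1. -/

theorem Matrix.sum_norm_sq_mulVec_le {m n : Type*} [Fintype m] [Fintype n] [DecidableEq n]
    (A : Matrix m n ℂ) (v : n → ℂ) :
    ∑ i, ‖∑ j, A i j * v j‖ ^ 2 ≤ ‖A‖ ^ 2 * ∑ j, ‖v j‖ ^ 2 := by
  have h := pow_le_pow_left₀ (norm_nonneg _) (A.l2_opNorm_mulVec (WithLp.toLp 2 v)) 2
  rw [mul_pow, EuclideanSpace.norm_sq_eq, EuclideanSpace.norm_sq_eq] at h
  exact h

theorem Fin.sum_pi_succ {κ R : Type*} [Fintype κ] [AddCommMonoid R] {k : ℕ}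
    (F : (Fin (k + 1) → κ) → R) :
    ∑ f, F f = ∑ f' : Fin k → κ, ∑ a, F (Fin.cons a f') := by
  rw [Finset.sum_comm, ← Fintype.sum_prod_type', ← (Fin.consEquiv fun _ => κ).sum_comp]
  rfl

/-- A Kronecker product of matrices acts on tensors with norm at most the product of the norms. -/
theorem Matrix.sum_norm_sq_piKronecker_le {m n : Type*} [Fintype m] [Fintype n] [DecidableEq n] :
    ∀ (k : ℕ) (X : Fin k → Matrix m n ℂ) (u : (Fin k → n) → ℂ),
      ∑ f : Fin k → m, ‖∑ g : Fin k → n, (∏ i, X i (f i) (g i)) * u g‖ ^ 2 ≤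
        (∏ i, ‖X i‖) ^ 2 * ∑ g, ‖u g‖ ^ 2
  | 0, X, u => by simp
  | k + 1, X, u => by
    -- The last `k` factors act on each slice of `u` with first index fixed; `X 0` then acts on that
    -- first index alone.
    set v : (Fin k → m) → n → ℂ := fun f' b =>
      ∑ g' : Fin k → n, (∏ i : Fin k, X i.succ (f' i) (g' i)) * u (Fin.cons b g') with hv
    have key (f' : Fin k → m) (a : m) :
        ∑ g : Fin (k + 1) → n,
            (∏ i, X i ((Fin.cons a f' : Fin (k + 1) → m) i) (g i)) * u g =
          ∑ b, X 0 a b * v f' b := by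
      rw [Fin.sum_pi_succ, Finset.sum_comm]
      refine Finset.sum_congr rfl fun b _ => ?_
      rw [hv, Finset.mul_sum]
      refine Finset.sum_congr rfl fun g' _ => ?_
      rw [Fin.prod_univ_succ]
      simp [mul_assoc]
    calc _ = ∑ f' : Fin k → m, ∑ a, ‖∑ b, X 0 a b * v f' b‖ ^ 2 := by
          rw [Fin.sum_pi_succ]; simp only [key]
      _ ≤ ∑ f' : Fin k → m, ‖X 0‖ ^ 2 * ∑ b, ‖v f' b‖ ^ 2 :=
          Finset.sum_le_sum fun f' _ => Matrix.sum_norm_sq_mulVec_le _ _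
      _ = ‖X 0‖ ^ 2 * ∑ b, ∑ f' : Fin k → m, ‖v f' b‖ ^ 2 := by
          rw [← Finset.mul_sum, Finset.sum_comm]
      _ ≤ ‖X 0‖ ^ 2 * ∑ b, ((∏ i : Fin k, ‖X i.succ‖) ^ 2 *
            ∑ g' : Fin k → n, ‖u (Fin.cons b g')‖ ^ 2) := by
          gcongr with b
          exact Matrix.sum_norm_sq_piKronecker_le k (fun i => X i.succ) fun g' => u (Fin.cons b g')
      _ = _ := by
          rw [Fin.sum_pi_succ, ← Finset.mul_sum, Finset.sum_comm, Fin.prod_univ_succ,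
            mul_pow, mul_assoc]

/-- Cauchy–Schwarz for ⟨1_S, (⊗ Xⁱ) 1_S⟩: each copy of 1_S contributes √n!. -/
theorem Matrix.norm_sum_perm_perm_le {n : ℕ} (X : Fin n → Matrix (Fin n) (Fin n) ℂ) :
    ‖∑ τ : Equiv.Perm (Fin n), ∑ σ : Equiv.Perm (Fin n), ∏ i, X i (τ i) (σ i)‖ ≤
      n.factorial * ∏ i, ‖X i‖ := by
  set S : Finset (Fin n → Fin n) :=
    (Finset.univ : Finset (Equiv.Perm (Fin n))).map
      ⟨fun σ : Equiv.Perm (Fin n) => (σ : Fin n → Fin n), DFunLike.coe_injective⟩ with hS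
  have hcard : S.card = n.factorial := by
    simp [hS, Fintype.card_perm]
  set K : (Fin n → Fin n) → ℂ := fun f =>
    ∑ g : Fin n → Fin n, (∏ i, X i (f i) (g i)) * (if g ∈ S then 1 else 0) with hK
  have h1 : ∑ τ : Equiv.Perm (Fin n), ∑ σ : Equiv.Perm (Fin n), ∏ i, X i (τ i) (σ i) =
      ∑ f ∈ S, K f := by
    simp [hK, hS, Finset.sum_map, -Finset.mem_map, Finset.sum_ite_mem]
  have h2 : ∑ f, ‖K f‖ ^ 2 ≤ (∏ i, ‖X i‖) ^ 2 * n.factorial := by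
    refine (Matrix.sum_norm_sq_piKronecker_le n X _).trans_eq ?_
    rw [← hcard]
    congr 1
    simp [apply_ite (fun z : ℂ => ‖z‖ ^ 2), -Finset.mem_map]
  rw [h1]
  refine (norm_sum_le _ _).trans (le_of_sq_le_sq ?_ (by positivity))
  calc (∑ f ∈ S, ‖K f‖) ^ 2 ≤ S.card * ∑ f ∈ S, ‖K f‖ ^ 2 := sq_sum_le_card_mul_sum_sq
    _ ≤ n.factorial * ((∏ i, ‖X i‖) ^ 2 * n.factorial) := by
        rw [hcard]
        gcongr
        exact (Finset.sum_le_univ_sum_of_nonneg fun _ => by positivity).trans h2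
    _ = _ := by ring

/-- For each fixed σ, the substitution τ ↦ τσ turns the inner sum into the permanent. -/
theorem Matrix.sum_perm_perm_eq_factorial_mul_permanent {n : ℕ} (A : Matrix (Fin n) (Fin n) ℂ) :
    ∑ τ : Equiv.Perm (Fin n), ∑ σ : Equiv.Perm (Fin n), ∏ i, A (τ i) (σ i) =
      n.factorial * A.permanent := by
  have h (σ : Equiv.Perm (Fin n)) :
      ∑ τ : Equiv.Perm (Fin n), ∏ i, A (τ i) (σ i) = A.permanent := by
    rw [Matrix.permanent, ← Equiv.sum_comp (Equiv.mulRight σ)]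
    refine Finset.sum_congr rfl fun τ _ => ?_
    rw [← Equiv.prod_comp σ fun i => A (τ i) i]
    rfl
  rw [Finset.sum_comm]
  simp [h, Fintype.card_perm]

/-- The full polarization of the permanent, normalized to be the permanent on the diagonal. -/
noncomputable def Matrix.mixedPermanent (n : ℕ) :
    ContinuousMultilinearMap ℂ (fun _ : Fin n => Matrix (Fin n) (Fin n) ℂ) ℂ :=
  MultilinearMap.mkContinuous
    ((n.factorial : ℂ)⁻¹ • ∑ τ : Equiv.Perm (Fin n), ∑ σ : Equiv.Perm (Fin n),
      (MultilinearMap.mkPiAlgebra ℂ (Fin n) ℂ).compLinearMap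
        fun i => Matrix.entryLinearMap ℂ ℂ (τ i) (σ i)) 1 fun X => by
    have hn : (0 : ℝ) < n.factorial := by exact_mod_cast n.factorial_pos
    have h := Matrix.norm_sum_perm_perm_le X
    simpa [sum_apply, inv_mul_le_iff₀ hn] using h

theorem Matrix.norm_mixedPermanent_le (n : ℕ) : ‖Matrix.mixedPermanent n‖ ≤ 1 :=
  MultilinearMap.mkContinuous_norm_le _ zero_le_one _

theorem Matrix.mixedPermanent_diag {n : ℕ} (A : Matrix (Fin n) (Fin n) ℂ) :
    Matrix.mixedPermanent n (fun _ => A) = A.permanent := by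
  have hn : (n.factorial : ℂ) ≠ 0 := by exact_mod_cast n.factorial_ne_zero
  have h := Matrix.sum_perm_perm_eq_factorial_mul_permanent A
  simp [Matrix.mixedPermanent, h, hn]

/-- The diagonal embedding is linear of norm at most 1 for the sup norm, so the derivative bounds
for `L` pull back along it. -/
theorem ContinuousMultilinearMap.norm_iteratedFDeriv_diag_le {𝕜 E F ι : Type*}
    [NontriviallyNormedField 𝕜] [NormedAddCommGroup E] [NormedSpace 𝕜 E] [NormedAddCommGroup F]
    [NormedSpace 𝕜 F] [Fintype ι] (L : ContinuousMultilinearMap 𝕜 (fun _ : ι => E) F)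
    (m : ℕ) (x : E) :
    ‖iteratedFDeriv 𝕜 m (fun y => L fun _ => y) x‖ ≤
      (Fintype.card ι).descFactorial m * ‖L‖ * ‖x‖ ^ (Fintype.card ι - m) := by
  set d : E →L[𝕜] (ι → E) := ContinuousLinearMap.pi fun _ => ContinuousLinearMap.id 𝕜 E
  have hd : ‖d‖ ≤ 1 :=
    ContinuousLinearMap.norm_pi_le_of_le (fun _ => ContinuousLinearMap.norm_id_le) zero_le_one
  have hdx : ‖d x‖ ≤ ‖x‖ := by simpa using d.le_of_opNorm_le hd x
  change ‖iteratedFDeriv 𝕜 m (L ∘ d) x‖ ≤ _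
  rw [d.iteratedFDeriv_comp_right (n := m) L.contDiff x le_rfl]
  calc _ ≤ ‖iteratedFDeriv 𝕜 m L (d x)‖ * ∏ _i : Fin m, ‖d‖ :=
        ContinuousMultilinearMap.norm_compContinuousLinearMap_le _ _
    _ ≤ ‖iteratedFDeriv 𝕜 m L (d x)‖ * 1 := by
        gcongr
        exact Finset.prod_le_one (fun _ _ => norm_nonneg _) fun _ _ => hd
    _ ≤ _ := by
        rw [mul_one]
        refine (L.norm_iteratedFDeriv_le m (d x)).trans ?_
        gcongr

/-- Expand over the set of slots holding `x`. The full set gives the subtracted term on both sides;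
the others are compared one by one. -/
theorem ContinuousMultilinearMap.norm_diag_add_sub_diag_le {𝕜 E F ι : Type*}
    [NontriviallyNormedField 𝕜] [NormedAddCommGroup E] [NormedSpace 𝕜 E] [NormedAddCommGroup F]
    [NormedSpace 𝕜 F] [Fintype ι] (L : ContinuousMultilinearMap 𝕜 (fun _ : ι => E) F)
    (hL : ‖L‖ ≤ 1) (x y : E) :
    ‖L (fun _ => x + y) - L fun _ => x‖ ≤
      (‖x‖ + ‖y‖) ^ Fintype.card ι - ‖x‖ ^ Fintype.card ι := by
  classical
  have h := L.map_add_univ (fun _ => x) fun _ => y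
  rw [← Finset.add_sum_erase _ _ (Finset.mem_univ Finset.univ), Finset.piecewise_univ] at h
  have hp := Fintype.sum_pow_mul_eq_add_pow ι ‖x‖ ‖y‖
  rw [← Finset.add_sum_erase _ _ (Finset.mem_univ Finset.univ)] at hp
  rw [show (fun _ : ι => x + y) = (fun _ => x) + fun _ => y from rfl, h, ← hp]
  simp only [Finset.card_univ, Nat.sub_self, pow_zero, mul_one, add_sub_cancel_left]
  refine norm_sum_le_of_le _ fun s _ => ?_
  refine (L.le_of_opNorm_le hL _).trans_eq ?_
  rw [one_mul, ← Finset.prod_mul_prod_compl s, ← Finset.card_compl]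
  congr 1
  · exact Finset.prod_eq_pow_card fun i hi => by simp [hi]
  · exact Finset.prod_eq_pow_card fun i hi => by simp [Finset.mem_compl.mp hi]

theorem one_add_pow_sub_one_eq_sum_Icc {R : Type*} [CommRing R] (x : R) (n : ℕ) :
    (1 + x) ^ n - 1 = ∑ k ∈ Finset.Icc 1 n, (n.choose k : R) * x ^ k := by
  rw [add_comm, add_pow, Finset.range_eq_Ico, Finset.sum_eq_sum_Ico_succ_bot n.succ_pos]
  simp [mul_comm, Finset.Ico_add_one_right_eq_Icc]

theorem mainTheorem3 (n : ℕ) :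
    ContDiff ℂ ∞ (fun M : Matrix (Fin n) (Fin n) ℂ => M.permanent) ∧
    (∀ (m : ℕ) (A : Matrix (Fin n) (Fin n) ℂ), 1 ≤ m → m ≤ n →
      ‖iteratedFDeriv ℂ m (fun M : Matrix (Fin n) (Fin n) ℂ => M.permanent) A‖ ≤
        (n.factorial : ℝ) / ((n - m).factorial : ℝ) * ‖A‖ ^ (n - m)) ∧
    (∀ A X : Matrix (Fin n) (Fin n) ℂ,
      ‖(A + X).permanent - A.permanent‖ ≤ (‖A‖ + ‖X‖) ^ n - ‖A‖ ^ n) ∧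
    (∀ x : ℝ, 0 ≤ x →
      ‖((1 : Matrix (Fin n) (Fin n) ℂ) + (x : ℂ) • (1 : Matrix (Fin n) (Fin n) ℂ)).permanent
          - (1 : Matrix (Fin n) (Fin n) ℂ).permanent‖ =
        ∑ k ∈ Finset.Icc 1 n, (n.choose k : ℝ) * x ^ k ∧
      (‖(1 : Matrix (Fin n) (Fin n) ℂ)‖ + ‖(x : ℂ) • (1 : Matrix (Fin n) (Fin n) ℂ)‖) ^ n
          - ‖(1 : Matrix (Fin n) (Fin n) ℂ)‖ ^ n =
        ∑ k ∈ Finset.Icc 1 n, (n.choose k : ℝ) * x ^ k) := by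
  have hper : (fun M : Matrix (Fin n) (Fin n) ℂ => M.permanent) =
      fun M => Matrix.mixedPermanent n fun _ => M :=
    funext fun M => (Matrix.mixedPermanent_diag M).symm
  refine ⟨?_, fun m A _ hmn => ?_, fun A X => ?_, fun x hx => ?_⟩
  · rw [hper]
    exact (Matrix.mixedPermanent n).contDiff.comp (contDiff_pi.2 fun _ => contDiff_id)
  · rw [hper]
    refine ((Matrix.mixedPermanent n).norm_iteratedFDeriv_diag_le m A).trans ?_
    have hfac : ((n.factorial : ℝ) / ((n - m).factorial : ℝ)) = n.descFactorial m := by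
      rw [div_eq_iff (by exact_mod_cast (n - m).factorial_ne_zero), mul_comm]
      exact_mod_cast (Nat.factorial_mul_descFactorial hmn).symm
    rw [hfac, Fintype.card_fin]
    gcongr
    exact mul_le_of_le_one_right (by positivity) (Matrix.norm_mixedPermanent_le n)
  · simpa [Matrix.mixedPermanent_diag] using
      (Matrix.mixedPermanent n).norm_diag_add_sub_diag_le (Matrix.norm_mixedPermanent_le n) A X
  · rw [← one_add_pow_sub_one_eq_sum_Icc]
    constructor
    · have h : (1 : Matrix (Fin n) (Fin n) ℂ) + (x : ℂ) • (1 : Matrix (Fin n) (Fin n) ℂ) =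
          Matrix.diagonal fun _ => ((1 + x : ℝ) : ℂ) := by
        ext i j
        by_cases hij : i = j <;> simp [hij]
      rw [h, Matrix.permanent_diagonal, Matrix.permanent_one, Finset.prod_const,
        Finset.card_univ, Fintype.card_fin, ← Complex.ofReal_pow, ← Complex.ofReal_one,
        ← Complex.ofReal_sub, Complex.norm_real, Real.norm_of_nonneg]
      exact sub_nonneg.2 (one_le_pow₀ (by linarith))
    -- The empty identity matrix has norm 0, so ‖1‖ = 1 needs positive size.
    · rcases n with _ | n
      · simp
      · rw [norm_smul, CStarRing.norm_one, Complex.norm_real, Real.norm_of_nonneg hx, mul_one,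
          one_pow]
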